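/- Let $n\ge 1$ be an integer. For $\delta\in(0,n]$ and $E\subset\mathbb{R}^n$ let $$\mathcal{H}^\delta_\infty(E):=\inf\Big\{\sum_i r_i^\delta : E\subset\bigcup_i B(x_i,r_i)\Big\}$$ be the $\delta$-dimensional Hausdorff content, where the infimum is over all countable (or finite) covers of $E$ by open balls. For an arbitrary (not necessarily measurable) set $\Omega\subset\mathbb{R}^n$ and function $g:\Omega\to[0,\infty]$, let $$\int_\Omega g\,d\mathcal{H}^\delta_\infty:=\int_0^\infty \mathcal{H}^\delta_\infty(\{x\in\Omega: g(x)>t\})\,dt$$ be its Choquet integral. For $f:\mathbb{R}^n\to[-\infty,\infty]$ and $\kappa\in[0,n)$ let $$\widetilde{\mathcal{M}}^n_\kappa f(x):=\sup_{B_r\ni x}\frac{r^\kappa}{\mathcal{H}^n_\infty(B_r)}\int_{B_r}|f(y)|\,d\mathcal{H}^n_\infty(y),$$ where the supremum is over all open balls $B_r$, of radius $r>0$ and with arbitrary centre, that contain $x$. Let $\delta\in(0,n]$, $\kappa\in[0,\delta)$ and $p\in(\delta/n,\delta/\kappa)$, where $\delta/\kappa:=\infty$ if $\kappa=0$. Then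 there exists a finite constant $c$, depending only on $n$, $\delta$, $\kappa$ and $p$, such that $$\bigg(\int_{\mathbb{R}^n}\big(\widetilde{\mathcal{M}}^n_\kappa f(x)\big)^{\frac{\delta p}{\delta-p\kappa}}\,d\mathcal{H}^\delta_\infty\bigg)^{\frac{\delta-p\kappa}{\delta p}}\le c\,\bigg(\int_{\mathbb{R}^n}|f(x)|^p\,d\mathcal{H}^\delta_\infty\bigg)^{\frac1p}$$ for all functions $f:\mathbb{R}^n\to[-\infty,\infty]$, measurable or not. -/

import Mathlib

open scoped NNReal ENNReal

namespace ChoquetContent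

/-- The `δ`-dimensional Hausdorff content of a set `A ⊆ ℝⁿ`: the infimum of `∑ rᵢ ^ δ` over all
countable covers of `A` by open balls `B(xᵢ, rᵢ)`. A radius `rᵢ = 0` gives the empty ball, which
contributes `0 ^ δ = 0` to the sum (for `δ > 0`), so finite covers and the empty cover are included
by padding with radii `0`. -/
noncomputable def hausdorffContent {n : ℕ} (δ : ℝ) (A : Set (EuclideanSpace ℝ (Fin n))) : ℝ≥0∞ :=
  ⨅ (x : ℕ → EuclideanSpace ℝ (Fin n)) (r : ℕ → ℝ≥0)
    (_ : A ⊆ ⋃ i, Metric.ball (x i) (r i : ℝ)), ∑' i, (r i : ℝ≥0∞) ^ δ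

/-- The Choquet integral `∫_Ω g dH := ∫₀^∞ H {x ∈ Ω : g x > t} dt` of an arbitrary function
`g : ℝⁿ → [0, ∞]` over an arbitrary set `Ω`, where `H` is the `δ`-dimensional Hausdorff content. -/
noncomputable def choquetIntegral {n : ℕ} (δ : ℝ) (Ω : Set (EuclideanSpace ℝ (Fin n)))
    (g : EuclideanSpace ℝ (Fin n) → ℝ≥0∞) : ℝ≥0∞ :=
  ∫⁻ t in Set.Ioi (0 : ℝ), hausdorffContent δ {x ∈ Ω | ENNReal.ofReal t < g x}

/-- The uncentred fractional maximal function with respect to the `d`-dimensional Hausdorff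
content: the supremum, over all open balls `B = B(y, r)` containing `x`, of
`r ^ κ / H(B) * ∫_B |f| dH`, where `H` is the `d`-dimensional Hausdorff content. -/
noncomputable def uncentredMaximal {n : ℕ} (d κ : ℝ) (f : EuclideanSpace ℝ (Fin n) → EReal)
    (x : EuclideanSpace ℝ (Fin n)) : ℝ≥0∞ :=
  ⨆ (y : EuclideanSpace ℝ (Fin n)) (r : ℝ) (_ : 0 < r) (_ : x ∈ Metric.ball y r),
    ENNReal.ofReal (r ^ κ) / hausdorffContent d (Metric.ball y r) *
      choquetIntegral d (Metric.ball y r) (fun z => (f z).abs)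

end ChoquetContent

/-!
The inequality rests on a weak-type estimate for the maximal function `M₀` of order zero, a
summation over dyadic levels, and a Hedberg-type inequality that passes from `M₀` to order `κ`.
Write `H` for the `δ`-dimensional content.

Let `q = δ / n ≤ 1`, and cover each level set `{|f| > b 2 ^ j}`, `j ≥ 0`, almost optimally by balls
`B(x_{ji}, ρ_{ji})`. Suppose `x` lies outside all the doubled balls and the average of `|f|` over a
ball of radius `r` containing `x` exceeds `2 b`. The levels above `b` carry half of this average,
and the covering balls that meet the ball of radius `r` have centres within `4 r` of `x`, so that
`r ^ n ≤ ∑ 2 ^ j ρ_{ji} ^ n` over those balls. By subadditivity of `t ↦ t ^ q`, raising this to the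
power `q` gives `r ^ δ ≤ μ (B(x, 4 r))`, where `μ` is the atomic measure with mass
`2 ^ {jq} ρ_{ji} ^ δ` at `x_{ji}`. The Vitali covering lemma (`exists_cover_of_le_measure`) then
bounds the content of the set of such `x` by the mass of `μ`, which is the estimate
`hausdorffContent_maximal_le`:
`H {M₀ f > 2 b} ≤ C ∑_j 2 ^ {jq} H {|f| > b 2 ^ j}`.
Passing to a measure on the centres of the covers replaces any use of subadditivity of the Choquet
integral, and no measurability of `f` enters.

Multiplying by `b ^ p` and summing over `b = 2 ^ k` leaves a geometric series with ratio
`2 ^ {q - p}`, which converges since `p > δ / n` (`tsum_levels_maximal_le`); this bounds the Choquet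
integral of `(M₀ f) ^ p`.

For order `κ`, the comparison of the `n`-dimensional content with `H ^ (n / δ)` and Chebyshev's
inequality show that an average over a ball of radius `r` is at most `C L r ^ {-δ/p}`, where `L`
bounds the norm of `f` (`average_le`). Interpolating between this and the bound by `M₀ f` gives
`M_κ f ≤ (C L) ^ θ (M₀ f) ^ {1 - θ}` with `θ = p κ / δ` (`uncentredMaximal_le_mul_rpow`), and raising
it to the power `δ p / (δ - p κ)` turns `(M₀ f) ^ {1 - θ}` into `(M₀ f) ^ p`.
-/

namespace ChoquetContent

open MeasureTheory Set Metric

/-! ### Hausdorff content -/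

theorem tsum_rpow_le_tsum_rpow {ι : Type*} (a : ι → ℝ≥0∞) {q : ℝ} (hq : 0 < q) (hq1 : q ≤ 1) :
    (∑' i, a i) ^ q ≤ ∑' i, a i ^ q := by
  have hfin : ∀ s : Finset ι, (∑ i ∈ s, a i) ^ q ≤ ∑ i ∈ s, a i ^ q := fun s =>
    Finset.le_sum_of_subadditive (fun x : ℝ≥0∞ => x ^ q) (by simp [hq])
      (fun x y => ENNReal.rpow_add_le_add_rpow x y hq.le hq1) s a
  rw [← ENNReal.le_rpow_inv_iff hq, ENNReal.tsum_eq_iSup_sum]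
  exact iSup_le fun s => (ENNReal.le_rpow_inv_iff hq).2 ((hfin s).trans (ENNReal.sum_le_tsum s))

variable {n : ℕ}

/-- Covers indexed by any countable type bound the content; they are padded to covers indexed by
`ℕ` with empty balls. -/
theorem hausdorffContent_le_tsum {ι : Type*} [Countable ι] {δ : ℝ} (hδ : 0 < δ)
    {A : Set (EuclideanSpace ℝ (Fin n))} (x : ι → EuclideanSpace ℝ (Fin n)) (r : ι → ℝ≥0)
    (hA : A ⊆ ⋃ i, ball (x i) (r i : ℝ)) :
    hausdorffContent δ A ≤ ∑' i, (r i : ℝ≥0∞) ^ δ := by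
  obtain ⟨e, he⟩ := Countable.exists_injective_nat ι
  have hcov : A ⊆ ⋃ k, ball (Function.extend e x 0 k) ((Function.extend e r 0 k : ℝ≥0) : ℝ) := by
    intro z hz
    obtain ⟨i, hi⟩ := mem_iUnion.1 (hA hz)
    exact mem_iUnion.2 ⟨e i, by rwa [he.extend_apply, he.extend_apply]⟩
  refine (iInf₂_le_of_le (Function.extend e x 0) (Function.extend e r 0)
    (iInf_le _ hcov)).trans_eq ?_
  rw [← tsum_extend_zero he]
  congr 1 with k
  by_cases hk : ∃ i, e i = k
  · obtain ⟨i, rfl⟩ := hk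
    rw [he.extend_apply, he.extend_apply]
  · rw [Function.extend_apply' _ _ _ hk, Function.extend_apply' _ _ _ hk]
    simp [hδ]

theorem hausdorffContent_mono (δ : ℝ) {A B : Set (EuclideanSpace ℝ (Fin n))} (h : A ⊆ B) :
    hausdorffContent δ A ≤ hausdorffContent δ B :=
  iInf_mono fun _ => iInf_mono fun _ => le_iInf fun hB => iInf_le _ (h.trans hB)

theorem exists_cover_tsum_lt {δ : ℝ} {A : Set (EuclideanSpace ℝ (Fin n))} {c : ℝ≥0∞}
    (h : hausdorffContent δ A < c) :
    ∃ (x : ℕ → EuclideanSpace ℝ (Fin n)) (r : ℕ → ℝ≥0), A ⊆ ⋃ i, ball (x i) (r i : ℝ) ∧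
      ∑' i, (r i : ℝ≥0∞) ^ δ < c := by
  simpa only [hausdorffContent, iInf_lt_iff, exists_prop] using h

/-- The `n`-dimensional content of a ball of radius `r` in `ℝⁿ` is exactly `r ^ n`: the lower bound
compares Lebesgue measures. -/
theorem hausdorffContent_ball (hn : 1 ≤ n) (y : EuclideanSpace ℝ (Fin n)) {r : ℝ} (hr : 0 < r) :
    hausdorffContent (n : ℝ) (ball y r) = ENNReal.ofReal (r ^ n) := by
  have hn0 : (0 : ℝ) < n := by exact_mod_cast hn
  apply le_antisymm
  · refine (hausdorffContent_le_tsum (ι := Unit) hn0 (fun _ => y) (fun _ => r.toNNReal) ?_).trans ?_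
    · exact fun z hz => mem_iUnion.2 ⟨(), by simpa [hr.le] using hz⟩
    · simp [ENNReal.ofReal, Real.toNNReal_pow hr.le]
  · refine le_iInf fun x => le_iInf fun ρ => le_iInf fun hcov => ?_
    have : Nonempty (Fin n) := ⟨⟨0, hn⟩⟩
    have hb : ∀ (z : EuclideanSpace ℝ (Fin n)) {s : ℝ}, 0 ≤ s →
        volume (ball z s) = ENNReal.ofReal (s ^ n) * volume (ball (0 : EuclideanSpace ℝ (Fin n)) 1) :=
      fun z s hs => by simpa using Measure.addHaar_ball volume z hs
    have h := (measure_mono (μ := volume) hcov).trans (measure_iUnion_le _)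
    simp only [hb _ hr.le, hb _ (NNReal.coe_nonneg _), ENNReal.tsum_mul_right] at h
    rw [ENNReal.mul_le_mul_iff_left (measure_ball_pos volume _ one_pos).ne'
      measure_ball_lt_top.ne] at h
    simpa [ENNReal.ofReal_pow] using h

/-- The embedding `ℓ^δ ⊆ ℓ^n` applied to the radii of a cover. -/
theorem hausdorffContent_le_rpow {δ : ℝ} (hδ : 0 < δ) (hδn : δ ≤ n)
    (A : Set (EuclideanSpace ℝ (Fin n))) :
    hausdorffContent (n : ℝ) A ≤ hausdorffContent δ A ^ ((n : ℝ) / δ) := by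
  have hn0 : (0 : ℝ) < n := hδ.trans_le hδn
  rw [← inv_div, ENNReal.le_rpow_inv_iff (by positivity)]
  refine le_iInf fun x => le_iInf fun ρ => le_iInf fun hcov => ?_
  calc hausdorffContent (n : ℝ) A ^ (δ / n)
      ≤ (∑' i, (ρ i : ℝ≥0∞) ^ (n : ℝ)) ^ (δ / n) := by
        gcongr
        exact hausdorffContent_le_tsum hn0 x ρ hcov
    _ ≤ ∑' i, ((ρ i : ℝ≥0∞) ^ (n : ℝ)) ^ (δ / n) :=
        tsum_rpow_le_tsum_rpow _ (by positivity) ((div_le_one hn0).2 hδn)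
    _ = ∑' i, (ρ i : ℝ≥0∞) ^ δ := by
        simp only [← ENNReal.rpow_mul, mul_div_cancel₀ _ hn0.ne']

/-! ### Integrals of antitone functions -/

theorem lintegral_Ioc_le_of_antitoneOn {φ : ℝ → ℝ≥0∞} (hφ : AntitoneOn φ (Ioi 0)) {s t : ℝ}
    (hs : 0 < s) : ∫⁻ u in Ioc s t, φ u ≤ ENNReal.ofReal (t - s) * φ s := by
  refine (setLIntegral_mono measurable_const (g := fun _ => φ s) fun u hu =>
    hφ hs (hs.trans hu.1) hu.1.le).trans_eq ?_
  rw [setLIntegral_const, Real.volume_Ioc, mul_comm]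

theorem le_lintegral_Ioc_of_antitoneOn {φ : ℝ → ℝ≥0∞} (hφ : AntitoneOn φ (Ioi 0)) {s t : ℝ}
    (hs : 0 ≤ s) : ENNReal.ofReal (t - s) * φ t ≤ ∫⁻ u in Ioc s t, φ u := by
  rw [mul_comm, ← Real.volume_Ioc, ← setLIntegral_const]
  refine setLIntegral_mono' measurableSet_Ioc fun u hu => ?_
  exact hφ (hs.trans_lt hu.1) (hs.trans_lt (hu.1.trans_le hu.2)) hu.2

theorem lintegral_Ioi_le_tsum_pow {φ : ℝ → ℝ≥0∞} (hφ : AntitoneOn φ (Ioi 0)) {b a : ℝ}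
    (hb : 0 < b) (ha : 1 < a) :
    ∫⁻ u in Ioi b, φ u ≤ ∑' j : ℕ, ENNReal.ofReal (b * a ^ j * (a - 1)) * φ (b * a ^ j) := by
  have ha0 : 0 < a := one_pos.trans ha
  have hsub : Ioi b ⊆ ⋃ j : ℕ, Ioc (b * a ^ j) (b * a ^ (j + 1)) := by
    intro u hu
    have hu' : 1 < u / b := (one_lt_div hb).2 hu
    obtain ⟨k, hk1, hk2⟩ := exists_mem_Ioc_zpow (one_pos.trans hu') ha
    have hk0 : 0 ≤ k := by
      by_contra! hk
      have : a ^ (k + 1) ≤ 1 := zpow_le_one_of_nonpos₀ ha.le (by lia)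
      linarith
    lift k to ℕ using hk0
    refine mem_iUnion.2 ⟨k, ?_, ?_⟩
    · rwa [lt_div_iff₀' hb, zpow_natCast] at hk1
    · rw [div_le_iff₀' hb] at hk2
      exact_mod_cast hk2
  refine ((lintegral_mono_set hsub).trans (lintegral_iUnion_le _ _)).trans ?_
  refine ENNReal.tsum_le_tsum fun j => ?_
  convert lintegral_Ioc_le_of_antitoneOn hφ (s := b * a ^ j) (t := b * a ^ (j + 1)) (by positivity)
    using 3
  ring

theorem lintegral_Ioi_le_tsum_zpow {φ : ℝ → ℝ≥0∞} (hφ : AntitoneOn φ (Ioi 0)) {b a : ℝ}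
    (hb : 0 < b) (ha : 1 < a) :
    ∫⁻ u in Ioi 0, φ u ≤ ∑' k : ℤ, ENNReal.ofReal (b * a ^ k * (a - 1)) * φ (b * a ^ k) := by
  have ha0 : 0 < a := one_pos.trans ha
  have hsub : Ioi 0 ⊆ ⋃ k : ℤ, Ioc (b * a ^ k) (b * a ^ (k + 1)) := by
    intro u hu
    obtain ⟨k, hk1, hk2⟩ := exists_mem_Ioc_zpow (div_pos hu hb) ha
    exact mem_iUnion.2 ⟨k, (lt_div_iff₀' hb).1 hk1, (div_le_iff₀' hb).1 hk2⟩
  refine ((lintegral_mono_set hsub).trans (lintegral_iUnion_le _ _)).trans ?_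
  refine ENNReal.tsum_le_tsum fun k => ?_
  convert lintegral_Ioc_le_of_antitoneOn hφ (s := b * a ^ k) (t := b * a ^ (k + 1)) (by positivity)
    using 3
  rw [zpow_add_one₀ ha0.ne']
  ring

theorem tsum_zpow_le_lintegral_Ioi {φ : ℝ → ℝ≥0∞} (hφ : AntitoneOn φ (Ioi 0)) {a : ℝ}
    (ha : 1 < a) :
    ∑' k : ℤ, ENNReal.ofReal (a ^ k) * φ (a ^ k) ≤
      ENNReal.ofReal (a / (a - 1)) * ∫⁻ u in Ioi 0, φ u := by
  have ha0 : 0 < a := one_pos.trans ha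
  have ha1 : 0 < a - 1 := sub_pos.2 ha
  have hmono : Monotone fun k : ℤ => a ^ (k - 1) := fun i j hij =>
    zpow_le_zpow_right₀ ha.le (by lia)
  have hdisj := hmono.pairwise_disjoint_on_Ioc_succ
  simp only [Int.succ_eq_succ, Int.succ, add_sub_cancel_right] at hdisj
  calc ∑' k : ℤ, ENNReal.ofReal (a ^ k) * φ (a ^ k)
      = ENNReal.ofReal (a / (a - 1)) *
          ∑' k : ℤ, ENNReal.ofReal (a ^ k - a ^ (k - 1)) * φ (a ^ k) := by
        rw [← ENNReal.tsum_mul_left]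
        congr 1 with k
        rw [← mul_assoc, ← ENNReal.ofReal_mul (by positivity), zpow_sub_one₀ ha0.ne']
        congr 2
        field_simp
    _ ≤ ENNReal.ofReal (a / (a - 1)) * ∑' k : ℤ, ∫⁻ u in Ioc (a ^ (k - 1)) (a ^ k), φ u := by
        gcongr with k
        exact le_lintegral_Ioc_of_antitoneOn hφ (by positivity)
    _ = ENNReal.ofReal (a / (a - 1)) * ∫⁻ u in ⋃ k : ℤ, Ioc (a ^ (k - 1)) (a ^ k), φ u := by
        rw [lintegral_iUnion (fun _ => measurableSet_Ioc) hdisj]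
    _ ≤ _ := by
        gcongr
        exact iUnion_subset fun k u hu => lt_trans (by positivity) hu.1

theorem antitone_hausdorffContent (δ : ℝ) (Ω : Set (EuclideanSpace ℝ (Fin n)))
    (g : EuclideanSpace ℝ (Fin n) → ℝ≥0∞) :
    Antitone fun t : ℝ => hausdorffContent δ {x ∈ Ω | ENNReal.ofReal t < g x} := fun _ _ hst =>
  hausdorffContent_mono δ fun _ hx => ⟨hx.1, (ENNReal.ofReal_le_ofReal hst).trans_lt hx.2⟩

theorem choquetIntegral_le_add_lintegral_Ioi (δ : ℝ) (Ω : Set (EuclideanSpace ℝ (Fin n)))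
    (g : EuclideanSpace ℝ (Fin n) → ℝ≥0∞) {b : ℝ} (hb : 0 ≤ b) :
    choquetIntegral δ Ω g ≤ ENNReal.ofReal b * hausdorffContent δ Ω +
      ∫⁻ t in Ioi b, hausdorffContent δ {x ∈ Ω | ENNReal.ofReal t < g x} := by
  rw [choquetIntegral, ← Ioc_union_Ioi_eq_Ioi hb]
  refine (lintegral_union_le _ _ _).trans ?_
  gcongr
  refine (setLIntegral_mono measurable_const (g := fun _ => hausdorffContent δ Ω) fun u _ =>
    hausdorffContent_mono δ (sep_subset _ _)).trans_eq ?_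
  rw [setLIntegral_const, Real.volume_Ioc, mul_comm, sub_zero]

/-! ### The weak-type estimate -/

/-- A weak-type estimate for finite measures: if every `x ∈ S` has a radius `r` such that the closed
ball of radius `4 * r` around `x` carries mass at least `r ^ δ`, then by the Vitali covering lemma
`S` is covered by balls whose radii, up to the factor `21`, have `δ`-th powers adding up to at most
the total mass. -/
theorem exists_cover_of_le_measure {δ : ℝ} (hδ : 0 < δ)
    (μ : Measure (EuclideanSpace ℝ (Fin n))) (hμ : μ univ ≠ ∞)
    (S : Set (EuclideanSpace ℝ (Fin n)))
    (hS : ∀ x ∈ S, ∃ r : ℝ≥0, 0 < r ∧ (r : ℝ≥0∞) ^ δ ≤ μ (closedBall x (4 * r))) :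
    ∃ (u : Set (EuclideanSpace ℝ (Fin n))) (r : EuclideanSpace ℝ (Fin n) → ℝ≥0), u.Countable ∧
      S ⊆ ⋃ x : u, ball (x : EuclideanSpace ℝ (Fin n)) (21 * r x : ℝ≥0) ∧
      ∑' x : u, (r x : ℝ≥0∞) ^ δ ≤ μ univ := by
  choose! r hr0 hr using hS
  have hbound : ∀ x ∈ S, (4 * r x : ℝ) ≤ 4 * (μ univ ^ δ⁻¹).toReal := by
    intro x hx
    have h1 : (r x : ℝ≥0∞) ≤ μ univ ^ δ⁻¹ :=
      (ENNReal.le_rpow_inv_iff hδ).2 ((hr x hx).trans (measure_mono (subset_univ _)))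
    have h2 := ENNReal.toReal_mono (ENNReal.rpow_ne_top_of_nonneg (by positivity) hμ) h1
    rw [ENNReal.coe_toReal] at h2
    linarith
  obtain ⟨u, huS, hdisj, hcov⟩ := Vitali.exists_disjoint_subfamily_covering_enlargement_closedBall
    S id (fun x => (4 * r x : ℝ)) _ hbound 5 (by norm_num)
  have hcount : u.Countable := hdisj.countable_of_nonempty_interior fun x hx => by
    have : (0 : ℝ) < 4 * r x := by have := hr0 x (huS hx); positivity
    exact ⟨x, ball_subset_interior_closedBall (mem_ball_self this)⟩
  refine ⟨u, r, hcount, fun x hx => ?_, ?_⟩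
  · obtain ⟨b, hb, hsub⟩ := hcov x hx
    refine mem_iUnion.2 ⟨⟨b, hb⟩, ?_⟩
    have h1 := hsub (mem_closedBall_self (by positivity))
    have h2 : (0 : ℝ) < r b := hr0 b (huS hb)
    simp only [id, mem_closedBall] at h1
    simp only [mem_ball, NNReal.coe_mul, NNReal.coe_ofNat]
    linarith
  · have := hcount.to_subtype
    calc ∑' x : u, (r x : ℝ≥0∞) ^ δ
        ≤ ∑' x : u, μ (closedBall (x : EuclideanSpace ℝ (Fin n)) (4 * r x)) :=
          ENNReal.tsum_le_tsum fun x => hr x (huS x.2)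
      _ = μ (⋃ x ∈ u, closedBall x (4 * r x)) :=
          (measure_biUnion hcount hdisj fun _ _ => measurableSet_closedBall).symm
      _ ≤ μ univ := measure_mono (subset_univ _)

theorem uncentredMaximal_lt_iff (hn : 1 ≤ n) (κ : ℝ) (f : EuclideanSpace ℝ (Fin n) → EReal)
    (x : EuclideanSpace ℝ (Fin n)) (c : ℝ≥0∞) :
    c < uncentredMaximal (n : ℝ) κ f x ↔ ∃ y, ∃ r : ℝ, 0 < r ∧ x ∈ ball y r ∧
      c < ENNReal.ofReal (r ^ κ) / ENNReal.ofReal (r ^ n) *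
        choquetIntegral (n : ℝ) (ball y r) (fun z => (f z).abs) := by
  simp only [uncentredMaximal, lt_iSup_iff, exists_prop]
  refine exists_congr fun y => exists_congr fun r => and_congr_right fun hr => ?_
  rw [hausdorffContent_ball hn y hr]

/-- If the average of `f` over a ball exceeds `2 * b`, then half of it is carried by the dyadic
levels above `b`. -/
theorem ofReal_pow_le_tsum_levels (hn : 1 ≤ n) {b : ℝ} (hb : 0 < b)
    (g : EuclideanSpace ℝ (Fin n) → ℝ≥0∞) (y : EuclideanSpace ℝ (Fin n)) {r : ℝ} (hr : 0 < r)
    (h : ENNReal.ofReal (2 * b) <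
      1 / ENNReal.ofReal (r ^ n) * choquetIntegral (n : ℝ) (ball y r) g) :
    ENNReal.ofReal (r ^ n) ≤ ∑' j : ℕ, 2 ^ j *
      hausdorffContent (n : ℝ) {z ∈ ball y r | ENNReal.ofReal (b * 2 ^ j) < g z} := by
  have hr0 : ENNReal.ofReal (r ^ n) ≠ 0 := by simp; positivity
  set T := ∑' j : ℕ, 2 ^ j *
      hausdorffContent (n : ℝ) {z ∈ ball y r | ENNReal.ofReal (b * 2 ^ j) < g z} with hT
  have hle : choquetIntegral (n : ℝ) (ball y r) g ≤
      ENNReal.ofReal b * ENNReal.ofReal (r ^ n) + ENNReal.ofReal b * T := by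
    refine (choquetIntegral_le_add_lintegral_Ioi _ _ _ hb.le).trans ?_
    rw [hausdorffContent_ball hn y hr]
    gcongr
    refine (lintegral_Ioi_le_tsum_pow ((antitone_hausdorffContent _ _ _).antitoneOn _) hb
      one_lt_two).trans_eq ?_
    rw [hT, ← ENNReal.tsum_mul_left]
    congr 1 with j
    rw [← mul_assoc, show b * 2 ^ j * (2 - 1) = b * 2 ^ j by ring, ENNReal.ofReal_mul hb.le,
      ENNReal.ofReal_pow zero_le_two, ENNReal.ofReal_ofNat]
  by_contra! hlt
  refine h.not_ge ?_
  rw [one_div, ENNReal.inv_mul_le_iff hr0 ENNReal.ofReal_ne_top]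
  calc _ ≤ _ := hle
    _ ≤ ENNReal.ofReal b * ENNReal.ofReal (r ^ n) + ENNReal.ofReal b * ENNReal.ofReal (r ^ n) := by
      gcongr
    _ = _ := by rw [ENNReal.ofReal_mul zero_le_two, ENNReal.ofReal_ofNat]; ring

/-- The weak-type estimate in terms of covers of the dyadic level sets of `f`: with the exponent
`δ / n ≤ 1` the powers of the radii of the covering balls add up to a finite atomic measure, and
away from the doubled covering balls only atoms near `x` contribute to an average around `x`. -/
theorem hausdorffContent_maximal_le_of_cover (hn : 1 ≤ n) {δ : ℝ} (hδ : 0 < δ) (hδn : δ ≤ n)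
    (f : EuclideanSpace ℝ (Fin n) → EReal) {b : ℝ} (hb : 0 < b)
    (c : ℕ → ℕ → EuclideanSpace ℝ (Fin n)) (ρ : ℕ → ℕ → ℝ≥0)
    (hcov : ∀ j, {x ∈ univ | ENNReal.ofReal (b * 2 ^ j) < (f x).abs} ⊆
      ⋃ i, ball (c j i) (ρ j i : ℝ)) :
    hausdorffContent δ {x ∈ univ | ENNReal.ofReal (2 * b) < uncentredMaximal (n : ℝ) 0 f x} ≤
      (2 ^ δ + 21 ^ δ) * ∑' j : ℕ, ((2 : ℝ≥0∞) ^ j) ^ (δ / n) * ∑' i, (ρ j i : ℝ≥0∞) ^ δ := by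
  have hn0 : (0 : ℝ) < n := hδ.trans_le hδn
  have hq : 0 < δ / n := by positivity
  have hq1 : δ / n ≤ 1 := (div_le_one hn0).2 hδn
  set T := ∑' j : ℕ, ((2 : ℝ≥0∞) ^ j) ^ (δ / n) * ∑' i, (ρ j i : ℝ≥0∞) ^ δ with hT
  let w : ℕ × ℕ → ℝ≥0∞ := fun k => ((2 : ℝ≥0∞) ^ k.1) ^ (δ / n) * (ρ k.1 k.2 : ℝ≥0∞) ^ δ
  have hTw : T = ∑' k, w k := by
    rw [ENNReal.tsum_prod']
    simp only [hT, w, ENNReal.tsum_mul_left]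
  by_cases hTtop : T = ∞
  · rw [hTtop, ENNReal.mul_top]
    · exact le_top
    · simp
  let μ : Measure (EuclideanSpace ℝ (Fin n)) :=
    Measure.sum fun k : ℕ × ℕ => w k • Measure.dirac (c k.1 k.2)
  have hμ : ∀ s, MeasurableSet s → μ s = ∑' k, w k * s.indicator 1 (c k.1 k.2) := fun s hs => by
    simp [μ, Measure.sum_apply _ hs, Measure.dirac_apply' _ hs]
  have hμuniv : μ univ = T := by rw [hμ _ .univ, hTw]; simp
  set S := {x ∈ univ | ENNReal.ofReal (2 * b) < uncentredMaximal (n : ℝ) 0 f x} with hSdef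
  set E : Set (EuclideanSpace ℝ (Fin n)) :=
    ⋃ k : ℕ × ℕ, ball (c k.1 k.2) (2 * ρ k.1 k.2 : ℝ≥0) with hE
  have hmass : ∀ x ∈ S \ E, ∃ r : ℝ≥0, 0 < r ∧ (r : ℝ≥0∞) ^ δ ≤ μ (closedBall x (4 * r)) := by
    rintro x ⟨⟨-, hxS⟩, hxE⟩
    obtain ⟨y, r, hr, hxy, hlt⟩ := (uncentredMaximal_lt_iff hn 0 f x _).1 hxS
    rw [Real.rpow_zero, ENNReal.ofReal_one] at hlt
    have hlev := ofReal_pow_le_tsum_levels hn hb _ y hr hlt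
    lift r to ℝ≥0 using hr.le
    refine ⟨r, hr, ?_⟩
    -- a covering ball that meets `ball y r` has its centre within `4 * r` of `x`, since otherwise
    -- its double would contain `x`
    have hnear : ∀ j i, (ball y r ∩ ball (c j i) (ρ j i)).Nonempty →
        c j i ∈ closedBall x (4 * r) := by
      rintro j i ⟨z, hzy, hzc⟩
      have h1 : (2 * ρ j i : ℝ) ≤ dist x (c j i) := by
        by_contra! h
        exact hxE (mem_iUnion.2 ⟨(j, i), by simpa using h⟩)
      have h2 := dist_triangle4_right x (c j i) y z
      simp only [mem_ball] at hxy hzy hzc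
      have h3 := dist_triangle4 x y z (c j i)
      rw [dist_comm y z] at h3
      rw [mem_closedBall, dist_comm]
      linarith
    have hlevel : ∀ j, hausdorffContent (n : ℝ)
        {z ∈ ball y r | ENNReal.ofReal (b * 2 ^ j) < (f z).abs} ≤
        ∑' i, (ρ j i : ℝ≥0∞) ^ (n : ℝ) * (closedBall x (4 * r)).indicator 1 (c j i) := by
      intro j
      let I : Set ℕ := {i | (ball y r ∩ ball (c j i) (ρ j i)).Nonempty}
      refine (hausdorffContent_le_tsum (ι := I) hn0 (fun i => c j i) (fun i => ρ j i) ?_).trans ?_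
      · rintro z ⟨hzy, hz⟩
        obtain ⟨i, hi⟩ := mem_iUnion.1 (hcov j ⟨mem_univ z, hz⟩)
        exact mem_iUnion.2 ⟨⟨i, z, hzy, hi⟩, hi⟩
      · rw [tsum_subtype I fun i => (ρ j i : ℝ≥0∞) ^ (n : ℝ)]
        refine ENNReal.tsum_le_tsum fun i => ?_
        by_cases hi : i ∈ I
        · rw [indicator_of_mem hi, indicator_of_mem (hnear j i hi)]
          simp
        · rw [indicator_of_notMem hi]
          exact zero_le
    have hsum : (r : ℝ≥0∞) ^ (n : ℝ) ≤ ∑' k : ℕ × ℕ, 2 ^ k.1 * ((ρ k.1 k.2 : ℝ≥0∞) ^ (n : ℝ) *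
        (closedBall x (4 * r)).indicator 1 (c k.1 k.2)) := by
      rw [ENNReal.tsum_prod']
      simp only [ENNReal.tsum_mul_left]
      refine le_trans ?_ (hlev.trans ?_)
      · simp [ENNReal.ofReal_pow]
      · gcongr with j
        exact hlevel j
    calc (r : ℝ≥0∞) ^ δ = ((r : ℝ≥0∞) ^ (n : ℝ)) ^ (δ / n) := by
          rw [← ENNReal.rpow_mul, mul_div_cancel₀ _ hn0.ne']
      _ ≤ _ := ENNReal.rpow_le_rpow hsum hq.le
      _ ≤ _ := tsum_rpow_le_tsum_rpow _ hq hq1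
      _ = μ (closedBall x (4 * r)) := by
          rw [hμ _ measurableSet_closedBall]
          congr 1 with k
          rw [ENNReal.mul_rpow_of_nonneg _ _ hq.le, ENNReal.mul_rpow_of_nonneg _ _ hq.le,
            ← ENNReal.rpow_mul, mul_div_cancel₀ _ hn0.ne', ← mul_assoc]
          by_cases hk : c k.1 k.2 ∈ closedBall x (4 * r)
          · simp [w, indicator_of_mem hk]
          · simp [indicator_of_notMem hk, hq]
  obtain ⟨u, r, hu, hScov, hSsum⟩ :=
    exists_cover_of_le_measure hδ μ (hμuniv ▸ hTtop) (S \ E) hmass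
  have := hu.to_subtype
  refine (hausdorffContent_le_tsum (ι := (ℕ × ℕ) ⊕ u) hδ
    (Sum.elim (fun k => c k.1 k.2) (fun x => x))
    (Sum.elim (fun k => 2 * ρ k.1 k.2) (fun x => 21 * r x)) ?_).trans ?_
  · intro x hx
    by_cases hxE : x ∈ E
    · obtain ⟨k, hk⟩ := mem_iUnion.1 hxE
      exact mem_iUnion.2 ⟨.inl k, hk⟩
    · obtain ⟨k, hk⟩ := mem_iUnion.1 (hScov ⟨hx, hxE⟩)
      exact mem_iUnion.2 ⟨.inr k, hk⟩
  · rw [ENNReal.summable.tsum_sum ENNReal.summable, add_mul]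
    simp only [Sum.elim_inl, Sum.elim_inr, ENNReal.coe_mul, ENNReal.coe_ofNat,
      ENNReal.mul_rpow_of_nonneg _ _ hδ.le, ENNReal.tsum_mul_left]
    gcongr
    · rw [hTw]
      refine ENNReal.tsum_le_tsum fun k => le_mul_of_one_le_left' ?_
      exact ENNReal.one_le_rpow (one_le_pow₀ one_le_two) hq
    · exact hSsum.trans_eq hμuniv

/-- The weak-type estimate for the maximal function of order zero, in terms of the contents of the
dyadic level sets of `f` above `b`. -/
theorem hausdorffContent_maximal_le (hn : 1 ≤ n) {δ : ℝ} (hδ : 0 < δ) (hδn : δ ≤ n)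
    (f : EuclideanSpace ℝ (Fin n) → EReal) {b : ℝ} (hb : 0 < b) :
    hausdorffContent δ {x ∈ univ | ENNReal.ofReal (2 * b) < uncentredMaximal (n : ℝ) 0 f x} ≤
      (2 ^ δ + 21 ^ δ) * ∑' j : ℕ, ((2 : ℝ≥0∞) ^ j) ^ (δ / n) *
        hausdorffContent δ {x ∈ univ | ENNReal.ofReal (b * 2 ^ j) < (f x).abs} := by
  have hq : 0 < δ / n := div_pos hδ (hδ.trans_le hδn)
  have hC : (2 ^ δ + 21 ^ δ : ℝ≥0∞) ≠ ∞ := by simp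
  have hw : ∀ j : ℕ, ((2 : ℝ≥0∞) ^ j) ^ (δ / n) ≠ 0 := fun j => by simp
  have hw' : ∀ j : ℕ, ((2 : ℝ≥0∞) ^ j) ^ (δ / n) ≠ ∞ := fun j => by simp
  by_cases htop : ∃ j : ℕ,
      hausdorffContent δ {x ∈ univ | ENNReal.ofReal (b * 2 ^ j) < (f x).abs} = ∞
  · obtain ⟨j, hj⟩ := htop
    have : ∑' j : ℕ, ((2 : ℝ≥0∞) ^ j) ^ (δ / n) *
        hausdorffContent δ {x ∈ univ | ENNReal.ofReal (b * 2 ^ j) < (f x).abs} = ∞ := by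
      refine ENNReal.tsum_eq_top_of_eq_top ⟨j, ?_⟩
      rw [hj, ENNReal.mul_top (hw j)]
    rw [this, ENNReal.mul_top (by simp)]
    exact le_top
  push Not at htop
  refine ENNReal.le_of_forall_pos_le_add fun ε hε _ => ?_
  have hε' : (ε : ℝ≥0∞) / (2 ^ δ + 21 ^ δ) ≠ 0 := ENNReal.div_ne_zero.2 ⟨by simpa using hε.ne', hC⟩
  obtain ⟨η, hη0, hη⟩ := ENNReal.exists_pos_tsum_mul_lt_of_countable hε' _ hw'
  choose c ρ hcov hsum using fun j : ℕ => exists_cover_tsum_lt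
    (ENNReal.lt_add_right (htop j) (ENNReal.coe_ne_zero.2 (hη0 j).ne'))
  refine (hausdorffContent_maximal_le_of_cover hn hδ hδn f hb c ρ hcov).trans ?_
  calc _ ≤ (2 ^ δ + 21 ^ δ) * ∑' j : ℕ, ((2 : ℝ≥0∞) ^ j) ^ (δ / n) *
        (hausdorffContent δ {x ∈ univ | ENNReal.ofReal (b * 2 ^ j) < (f x).abs} + η j) := by
        gcongr with j
        exact (hsum j).le
    _ ≤ _ := by
        simp only [mul_add _ _ (η _ : ℝ≥0∞)]
        rw [ENNReal.tsum_add, mul_add]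
        gcongr
        exact (mul_comm _ _).trans_le (ENNReal.mul_le_of_le_div hη.le)

/-! ### The strong-type estimate -/

theorem ofReal_rpow_zpow_lt_iff {p : ℝ} (hp : 0 < p) (k : ℤ) (x : ℝ≥0∞) :
    ENNReal.ofReal (((2 : ℝ) ^ p) ^ k) < x ^ p ↔ ENNReal.ofReal ((2 : ℝ) ^ k) < x := by
  rw [← Real.rpow_intCast, ← Real.rpow_mul zero_le_two, mul_comm, Real.rpow_mul zero_le_two,
    Real.rpow_intCast, ← ENNReal.ofReal_rpow_of_pos (by positivity), ENNReal.rpow_lt_rpow_iff hp]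

/-- Discretisation of the Choquet integral of `g ^ p` by the dyadic level sets of `g`. -/
theorem tsum_levels_le_choquetIntegral (δ : ℝ) {p : ℝ} (hp : 0 < p)
    (g : EuclideanSpace ℝ (Fin n) → ℝ≥0∞) :
    ∑' k : ℤ, ENNReal.ofReal (((2 : ℝ) ^ p) ^ k) *
        hausdorffContent δ {x ∈ univ | ENNReal.ofReal ((2 : ℝ) ^ k) < g x} ≤
      ENNReal.ofReal (2 ^ p / (2 ^ p - 1)) * choquetIntegral δ univ (fun x => g x ^ p) := by
  have h := tsum_zpow_le_lintegral_Ioi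
    ((antitone_hausdorffContent δ univ (fun x => g x ^ p)).antitoneOn _)
    (Real.one_lt_rpow one_lt_two hp)
  simp only [ofReal_rpow_zpow_lt_iff hp] at h
  exact h

/-- Summation of the weak-type estimate over all dyadic levels; the geometric series in `j`
converges because `δ / n < p`. -/
theorem tsum_levels_maximal_le (hn : 1 ≤ n) {δ p : ℝ} (hδ : 0 < δ) (hδn : δ ≤ n)
    (f : EuclideanSpace ℝ (Fin n) → EReal) :
    ∑' k : ℤ, ENNReal.ofReal (((2 : ℝ) ^ p) ^ k) * hausdorffContent δ
        {x ∈ univ | ENNReal.ofReal (2 * 2 ^ k) < uncentredMaximal (n : ℝ) 0 f x} ≤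
      (2 ^ δ + 21 ^ δ) * (∑' j : ℕ, ENNReal.ofReal (2 ^ (δ / n - p)) ^ j) *
        ∑' k : ℤ, ENNReal.ofReal (((2 : ℝ) ^ p) ^ k) *
          hausdorffContent δ {x ∈ univ | ENNReal.ofReal ((2 : ℝ) ^ k) < (f x).abs} := by
  set h : ℤ → ℝ≥0∞ := fun k =>
    hausdorffContent δ {x ∈ univ | ENNReal.ofReal ((2 : ℝ) ^ k) < (f x).abs} with hh
  have hweak : ∀ k : ℤ, hausdorffContent δ
      {x ∈ univ | ENNReal.ofReal (2 * 2 ^ k) < uncentredMaximal (n : ℝ) 0 f x} ≤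
        (2 ^ δ + 21 ^ δ) * ∑' j : ℕ, ((2 : ℝ≥0∞) ^ j) ^ (δ / n) * h (k + j) := fun k => by
    refine (hausdorffContent_maximal_le hn hδ hδn f (b := (2 : ℝ) ^ k) (by positivity)).trans_eq ?_
    simp only [hh, zpow_add₀ (two_ne_zero' ℝ), zpow_natCast]
  have hcoef : ∀ (k : ℤ) (j : ℕ), ENNReal.ofReal (((2 : ℝ) ^ p) ^ k) * ((2 : ℝ≥0∞) ^ j) ^ (δ / n) =
      ENNReal.ofReal (2 ^ (δ / n - p)) ^ j * ENNReal.ofReal (((2 : ℝ) ^ p) ^ (k + j)) := by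
    intro k j
    rw [← ENNReal.ofReal_ofNat, ← ENNReal.ofReal_pow zero_le_two,
      ENNReal.ofReal_rpow_of_pos (by positivity), ← ENNReal.ofReal_pow (by positivity),
      ← ENNReal.ofReal_mul (by positivity), ← ENNReal.ofReal_mul (by positivity)]
    congr 1
    simp only [← Real.rpow_natCast, ← Real.rpow_intCast, ← Real.rpow_mul zero_le_two,
      ← Real.rpow_add two_pos]
    congr 1
    push_cast
    ring
  calc _ ≤ ∑' k : ℤ, ENNReal.ofReal (((2 : ℝ) ^ p) ^ k) *
          ((2 ^ δ + 21 ^ δ) * ∑' j : ℕ, ((2 : ℝ≥0∞) ^ j) ^ (δ / n) * h (k + j)) := by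
        gcongr with k
        exact hweak k
    _ = (2 ^ δ + 21 ^ δ) * ∑' k : ℤ, ∑' j : ℕ, ENNReal.ofReal (2 ^ (δ / n - p)) ^ j *
          (ENNReal.ofReal (((2 : ℝ) ^ p) ^ (k + j)) * h (k + j)) := by
        rw [← ENNReal.tsum_mul_left]
        congr 1 with k
        rw [mul_left_comm, ← ENNReal.tsum_mul_left]
        congr 2 with j
        rw [← mul_assoc, hcoef, mul_assoc]
    _ = _ := by
        rw [ENNReal.tsum_comm, mul_assoc, ← ENNReal.tsum_mul_right]
        congr 2 with j
        rw [ENNReal.tsum_mul_left]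
        congr 1
        exact (Equiv.addRight (j : ℤ)).tsum_eq
          fun k : ℤ => ENNReal.ofReal (((2 : ℝ) ^ p) ^ k) * h k

/-! ### The Hedberg-type inequality -/

/-- Chebyshev's inequality for the Choquet integral. -/
theorem hausdorffContent_level_le (δ : ℝ) {p L t : ℝ} (hp : 0 < p) (hL : 0 < L) (ht : 0 < t)
    (g : EuclideanSpace ℝ (Fin n) → ℝ≥0∞)
    (hI : choquetIntegral δ univ (fun x => g x ^ p) ≤ ENNReal.ofReal (L ^ p)) :
    hausdorffContent δ {x ∈ univ | ENNReal.ofReal t < g x} ≤ ENNReal.ofReal ((L / t) ^ p) := by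
  have h := le_lintegral_Ioc_of_antitoneOn (s := 0) (t := t ^ p)
    ((antitone_hausdorffContent δ univ (fun x => g x ^ p)).antitoneOn _) le_rfl
  simp only [← ENNReal.ofReal_rpow_of_pos ht, ENNReal.rpow_lt_rpow_iff hp, sub_zero] at h
  have h' := (h.trans (lintegral_mono_set Ioc_subset_Ioi_self)).trans hI
  rw [Real.div_rpow hL.le ht.le, ENNReal.ofReal_div_of_pos (by positivity),
    ENNReal.le_div_iff_mul_le (.inl (by simp; positivity)) (.inl ENNReal.ofReal_ne_top), mul_comm]
  rwa [← ENNReal.ofReal_rpow_of_pos ht]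

/-- Averages over a ball of radius `r` decay like `r ^ (-δ / p)`. The integral is split at the
height `L * r ^ (-δ / p)`; the tail converges because `1 < p * n / δ`. -/
theorem average_le (hn : 1 ≤ n) {δ p L : ℝ} (hδ : 0 < δ) (hδn : δ ≤ n)
    (hp : δ / n < p) (hL : 0 < L) (g : EuclideanSpace ℝ (Fin n) → ℝ≥0∞)
    (hI : choquetIntegral δ univ (fun x => g x ^ p) ≤ ENNReal.ofReal (L ^ p))
    (y : EuclideanSpace ℝ (Fin n)) {r : ℝ} (hr : 0 < r) :
    1 / ENNReal.ofReal (r ^ n) * choquetIntegral (n : ℝ) (ball y r) g ≤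
      ENNReal.ofReal ((1 + 1 / (p * (n / δ) - 1)) * (L * r ^ (-(δ / p)))) := by
  have hn0 : (0 : ℝ) < n := hδ.trans_le hδn
  have hp0 : 0 < p := (div_pos hδ hn0).trans hp
  set β : ℝ := p * (n / δ) with hβ
  have hβ1 : 1 < β := by
    rw [div_lt_iff₀ hn0] at hp
    rw [hβ, ← mul_div_assoc, one_lt_div hδ]
    exact hp
  have hβ0 : 0 < β - 1 := sub_pos.2 hβ1
  set b : ℝ := L * r ^ (-(δ / p)) with hb
  have hb0 : 0 < b := by positivity
  have hr0 : ENNReal.ofReal (r ^ n) ≠ 0 := by simp; positivity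
  have hlevel : ∀ t ∈ Ioi b, hausdorffContent (n : ℝ) {x ∈ ball y r | ENNReal.ofReal t < g x} ≤
      ENNReal.ofReal (L ^ β * t ^ (-β)) := by
    intro t ht
    have ht0 : 0 < t := hb0.trans ht
    calc hausdorffContent (n : ℝ) {x ∈ ball y r | ENNReal.ofReal t < g x}
        ≤ hausdorffContent (n : ℝ) {x ∈ univ | ENNReal.ofReal t < g x} :=
          hausdorffContent_mono _ fun x hx => ⟨mem_univ x, hx.2⟩
      _ ≤ hausdorffContent δ {x ∈ univ | ENNReal.ofReal t < g x} ^ ((n : ℝ) / δ) :=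
          hausdorffContent_le_rpow hδ hδn _
      _ ≤ ENNReal.ofReal ((L / t) ^ p) ^ ((n : ℝ) / δ) := by
          gcongr
          exact hausdorffContent_level_le δ hp0 hL ht0 g hI
      _ = ENNReal.ofReal (L ^ β * t ^ (-β)) := by
          rw [ENNReal.ofReal_rpow_of_pos (by positivity), ← Real.rpow_mul (by positivity),
            Real.div_rpow hL.le ht0.le, Real.rpow_neg ht0.le, div_eq_mul_inv]
  have htail : ∫⁻ t in Ioi b, hausdorffContent (n : ℝ) {x ∈ ball y r | ENNReal.ofReal t < g x} ≤
      ENNReal.ofReal (b * r ^ n / (β - 1)) := by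
    refine (setLIntegral_mono' measurableSet_Ioi hlevel).trans_eq ?_
    rw [← ofReal_integral_eq_lintegral_ofReal
      ((integrableOn_Ioi_rpow_of_lt (neg_lt_neg hβ1) hb0).const_mul _)
      ((ae_restrict_iff' measurableSet_Ioi).2 (.of_forall fun t ht => by
        have : 0 < t := hb0.trans ht
        simp only [Pi.zero_apply]; positivity)),
      integral_const_mul, integral_Ioi_rpow_of_lt (neg_lt_neg hβ1) hb0]
    congr 1
    have h1 : b ^ (-β + 1) = b * (L ^ (-β) * r ^ n) := by
      rw [Real.rpow_add_one hb0.ne', mul_comm]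
      congr 1
      rw [hb, Real.mul_rpow hL.le (by positivity), ← Real.rpow_mul hr.le, ← Real.rpow_natCast]
      congr 2
      rw [hβ]
      field_simp
    have h2 : L ^ β * L ^ (-β) = 1 := by rw [← Real.rpow_add hL]; simp
    rw [h1, show -β + 1 = -(β - 1) by ring, neg_div_neg_eq]
    linear_combination (b * r ^ n / (β - 1)) * h2
  rw [one_div, ENNReal.inv_mul_le_iff hr0 ENNReal.ofReal_ne_top]
  refine (choquetIntegral_le_add_lintegral_Ioi _ _ _ hb0.le).trans ?_
  rw [hausdorffContent_ball hn y hr]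
  refine (add_le_add_right htail _).trans_eq ?_
  rw [← ENNReal.ofReal_mul hb0.le, ← ENNReal.ofReal_add (by positivity) (by positivity),
    ← ENNReal.ofReal_mul (by positivity)]
  congr 1
  ring

/-- A Hedberg-type inequality: the fractional maximal function is controlled by a power of the
maximal function of order zero, through the geometric mean of the two bounds for an average. -/
theorem uncentredMaximal_le_mul_rpow (hn : 1 ≤ n) {δ κ p L : ℝ} (hδ : 0 < δ) (hδn : δ ≤ n)
    (hκ : 0 ≤ κ) (hp : δ / n < p) (hpκ : p * κ < δ) (hL : 0 < L)
    (f : EuclideanSpace ℝ (Fin n) → EReal)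
    (hI : choquetIntegral δ univ (fun x => (f x).abs ^ p) ≤ ENNReal.ofReal (L ^ p))
    (x : EuclideanSpace ℝ (Fin n)) :
    uncentredMaximal (n : ℝ) κ f x ≤
      ENNReal.ofReal ((1 + 1 / (p * (n / δ) - 1)) * L) ^ (p * κ / δ) *
        uncentredMaximal (n : ℝ) 0 f x ^ (1 - p * κ / δ) := by
  have hn0 : (0 : ℝ) < n := hδ.trans_le hδn
  have hp0 : 0 < p := (div_pos hδ hn0).trans hp
  have hθ0 : 0 ≤ p * κ / δ := by positivity
  have hθ1 : 0 ≤ 1 - p * κ / δ := sub_nonneg.2 ((div_le_one hδ).2 hpκ.le)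
  set K := 1 + 1 / (p * (n / δ) - 1) with hK
  have hK0 : 0 < K := by
    have : 0 < p * (n / δ) - 1 := by
      rw [div_lt_iff₀ hn0] at hp
      rwa [sub_pos, ← mul_div_assoc, one_lt_div hδ]
    positivity
  refine le_of_forall_lt fun c hc => ?_
  obtain ⟨y, r, hr, hxy, hlt⟩ := (uncentredMaximal_lt_iff hn κ f x c).1 hc
  refine hlt.trans_le ?_
  set a := 1 / ENNReal.ofReal (r ^ n) * choquetIntegral (n : ℝ) (ball y r) (fun z => (f z).abs)
    with ha
  have ha1 : a ≤ uncentredMaximal (n : ℝ) 0 f x := by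
    refine le_of_forall_lt fun c hc => (uncentredMaximal_lt_iff hn 0 f x c).2 ⟨y, r, hr, hxy, ?_⟩
    rwa [Real.rpow_zero, ENNReal.ofReal_one]
  have ha2 : a ≤ ENNReal.ofReal (K * (L * r ^ (-(δ / p)))) :=
    average_le hn hδ hδn hp hL _ hI y hr
  calc ENNReal.ofReal (r ^ κ) / ENNReal.ofReal (r ^ n) *
        choquetIntegral (n : ℝ) (ball y r) (fun z => (f z).abs)
      = ENNReal.ofReal (r ^ κ) * (a ^ (p * κ / δ) * a ^ (1 - p * κ / δ)) := by
        rw [← ENNReal.rpow_add_of_nonneg _ _ hθ0 hθ1, add_sub_cancel, ENNReal.rpow_one, ha,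
          one_div, div_eq_mul_inv, mul_assoc]
    _ ≤ ENNReal.ofReal (r ^ κ) * (ENNReal.ofReal (K * (L * r ^ (-(δ / p)))) ^ (p * κ / δ) *
          uncentredMaximal (n : ℝ) 0 f x ^ (1 - p * κ / δ)) := by
        gcongr
    _ = _ := by
        rw [← mul_assoc]
        congr 1
        rw [ENNReal.ofReal_rpow_of_pos (by positivity), ENNReal.ofReal_rpow_of_pos (by positivity),
          ← ENNReal.ofReal_mul (by positivity), ← mul_assoc, Real.mul_rpow (by positivity)
          (by positivity), ← Real.rpow_mul hr.le, mul_left_comm, ← Real.rpow_add hr]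
        have : κ + -(δ / p) * (p * κ / δ) = 0 := by field_simp; ring
        rw [this, Real.rpow_zero, mul_one]

/-! ### Boundedness of the fractional maximal function -/

/-- The strong-type inequality for the fractional maximal function, with the norm of `f` on the
right-hand side replaced by an arbitrary positive number `L` above it. -/
theorem choquetIntegral_uncentredMaximal_le (n : ℕ) (hn : 1 ≤ n) (δ κ p : ℝ) (hδ : 0 < δ)
    (hδn : δ ≤ (n : ℝ)) (hκ : 0 ≤ κ) (hp : δ / (n : ℝ) < p) (hpκ : p * κ < δ) :
    ∃ c : ℝ≥0, ∀ (f : EuclideanSpace ℝ (Fin n) → EReal) (L : ℝ), 0 < L →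
      choquetIntegral δ univ (fun x => (f x).abs ^ p) ≤ ENNReal.ofReal (L ^ p) →
      choquetIntegral δ univ
        (fun x => uncentredMaximal (n : ℝ) κ f x ^ (δ * p / (δ - p * κ))) ≤
          c * ENNReal.ofReal L ^ (δ * p / (δ - p * κ)) := by
  have hn0 : (0 : ℝ) < n := hδ.trans_le hδn
  have hp0 : 0 < p := (div_pos hδ hn0).trans hp
  have hd : 0 < δ - p * κ := sub_pos.2 hpκ
  set s := δ * p / (δ - p * κ) with hs
  have hs0 : 0 < s := by positivity
  have hθs : p * κ / δ * s + p = s := by rw [hs]; field_simp; ring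
  have hθs' : (1 - p * κ / δ) * s = p := by rw [hs]; field_simp
  set K := 1 + 1 / (p * (n / δ) - 1) with hK
  have hK0 : 0 < K := by
    have : 0 < p * (n / δ) - 1 := by
      rw [div_lt_iff₀ hn0] at hp
      rwa [sub_pos, ← mul_div_assoc, one_lt_div hδ]
    positivity
  have h2p : 1 < (2 : ℝ) ^ p := Real.one_lt_rpow one_lt_two hp0
  have h2p' : 0 < (2 : ℝ) ^ p - 1 := sub_pos.2 h2p
  set G : ℝ≥0∞ := (2 ^ δ + 21 ^ δ) * ∑' j : ℕ, ENNReal.ofReal (2 ^ (δ / n - p)) ^ j with hG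
  have hGtop : G ≠ ∞ := by
    refine ENNReal.mul_ne_top (by simp) ?_
    rw [ENNReal.tsum_geometric, ENNReal.inv_ne_top]
    refine (tsub_pos_of_lt ?_).ne'
    rw [ENNReal.ofReal_lt_one]
    exact Real.rpow_lt_one_of_one_lt_of_neg one_lt_two (sub_neg.2 hp)
  set C : ℝ≥0∞ := ENNReal.ofReal (K ^ (p * κ / δ * s) * 2 ^ p * (2 ^ p - 1)) *
    (G * ENNReal.ofReal (2 ^ p / (2 ^ p - 1))) with hC
  have hCtop : C ≠ ∞ := ENNReal.mul_ne_top ENNReal.ofReal_ne_top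
    (ENNReal.mul_ne_top hGtop ENNReal.ofReal_ne_top)
  refine ⟨C.toNNReal, fun f L hL hI => ?_⟩
  rw [ENNReal.coe_toNNReal hCtop]
  set D : ℝ := (K * L) ^ (p * κ / δ * s) with hD
  have hD0 : 0 < D := by positivity
  have hpoint : ∀ x, uncentredMaximal (n : ℝ) κ f x ^ s ≤
      ENNReal.ofReal D * uncentredMaximal (n : ℝ) 0 f x ^ p := by
    intro x
    refine (ENNReal.rpow_le_rpow (uncentredMaximal_le_mul_rpow hn hδ hδn hκ hp hpκ hL f hI x)
      hs0.le).trans_eq ?_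
    rw [ENNReal.mul_rpow_of_nonneg _ _ hs0.le, ← ENNReal.rpow_mul, ← ENNReal.rpow_mul, hθs',
      ENNReal.ofReal_rpow_of_pos (by positivity)]
  have hset : ∀ k : ℤ, hausdorffContent δ {x ∈ univ |
      ENNReal.ofReal (D * 2 ^ p * (2 ^ p) ^ k) < uncentredMaximal (n : ℝ) κ f x ^ s} ≤
      hausdorffContent δ {x ∈ univ |
        ENNReal.ofReal (2 * 2 ^ k) < uncentredMaximal (n : ℝ) 0 f x} := by
    refine fun k => hausdorffContent_mono _ fun x hx => ⟨hx.1, ?_⟩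
    have h := hx.2.trans_le (hpoint x)
    rw [mul_assoc, ENNReal.ofReal_mul hD0.le] at h
    have h := lt_of_mul_lt_mul_left' h
    -- `2 ^ p * (2 ^ p) ^ k` is the level `2 ^ (k + 1)` raised to the power `p`
    rwa [mul_comm, ← zpow_add_one₀ (by positivity), ofReal_rpow_zpow_lt_iff hp0,
      zpow_add_one₀ two_ne_zero, mul_comm] at h
  calc choquetIntegral δ univ (fun x => uncentredMaximal (n : ℝ) κ f x ^ s)
      ≤ ∑' k : ℤ, ENNReal.ofReal (D * 2 ^ p * (2 ^ p) ^ k * (2 ^ p - 1)) *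
          hausdorffContent δ {x ∈ univ |
            ENNReal.ofReal (D * 2 ^ p * (2 ^ p) ^ k) < uncentredMaximal (n : ℝ) κ f x ^ s} :=
        lintegral_Ioi_le_tsum_zpow ((antitone_hausdorffContent _ _ _).antitoneOn _)
          (by positivity) h2p
    _ ≤ ENNReal.ofReal (D * 2 ^ p * (2 ^ p - 1)) *
          ∑' k : ℤ, ENNReal.ofReal (((2 : ℝ) ^ p) ^ k) * hausdorffContent δ {x ∈ univ |
            ENNReal.ofReal (2 * 2 ^ k) < uncentredMaximal (n : ℝ) 0 f x} := by
        rw [← ENNReal.tsum_mul_left]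
        refine ENNReal.tsum_le_tsum fun k => ?_
        rw [← mul_assoc, ← ENNReal.ofReal_mul (by positivity), mul_right_comm (D * 2 ^ p)]
        gcongr
        exact hset k
    _ ≤ ENNReal.ofReal (D * 2 ^ p * (2 ^ p - 1)) *
          (G * (ENNReal.ofReal (2 ^ p / (2 ^ p - 1)) * ENNReal.ofReal (L ^ p))) := by
        gcongr
        refine (tsum_levels_maximal_le hn hδ hδn f).trans ?_
        gcongr
        refine (tsum_levels_le_choquetIntegral δ hp0 _).trans ?_
        gcongr
    _ = C * ENNReal.ofReal L ^ s := by
        have hDL : D * 2 ^ p * (2 ^ p - 1) =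
            K ^ (p * κ / δ * s) * 2 ^ p * (2 ^ p - 1) * L ^ (p * κ / δ * s) := by
          rw [hD, Real.mul_rpow hK0.le hL.le]
          ring
        have hLs : ENNReal.ofReal L ^ s =
            ENNReal.ofReal (L ^ (p * κ / δ * s)) * ENNReal.ofReal (L ^ p) := by
          rw [ENNReal.ofReal_rpow_of_pos hL, ← ENNReal.ofReal_mul (by positivity),
            ← Real.rpow_add hL, hθs]
        rw [hDL, ENNReal.ofReal_mul (by positivity), hC, hLs]
        ring

end ChoquetContent

theorem mainTheorem8 (n : ℕ) (hn : 1 ≤ n) (δ κ p : ℝ) (hδ : 0 < δ) (hδn : δ ≤ (n : ℝ))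
    (hκ : 0 ≤ κ) (hκδ : κ < δ) (hp : δ / (n : ℝ) < p) (hpκ : p * κ < δ) :
    ∃ c : ℝ≥0, ∀ f : EuclideanSpace ℝ (Fin n) → EReal,
      (ChoquetContent.choquetIntegral δ Set.univ (fun x =>
          ChoquetContent.uncentredMaximal (n : ℝ) κ f x ^ (δ * p / (δ - p * κ)))) ^
            ((δ - p * κ) / (δ * p)) ≤
        (c : ℝ≥0∞) *
          (ChoquetContent.choquetIntegral δ Set.univ (fun x => (f x).abs ^ p)) ^ (1 / p) := by
  obtain ⟨c, hc⟩ :=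
    ChoquetContent.choquetIntegral_uncentredMaximal_le n hn δ κ p hδ hδn hκ hp hpκ
  have hp0 : 0 < p := (div_pos hδ (hδ.trans_le hδn)).trans hp
  have hd : 0 < δ - p * κ := sub_pos.2 hpκ
  have hs0 : 0 < (δ - p * κ) / (δ * p) := by positivity
  -- the summand `1` makes the constant nonzero, so that it can be divided by
  refine ⟨c ^ ((δ - p * κ) / (δ * p)) + 1, fun f => ?_⟩
  set I := ChoquetContent.choquetIntegral δ Set.univ (fun x => (f x).abs ^ p) with hI
  have hc0 : ((c ^ ((δ - p * κ) / (δ * p)) + 1 : ℝ≥0) : ℝ≥0∞) ≠ 0 := by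
    simp
  rw [← ENNReal.div_le_iff' hc0 ENNReal.coe_ne_top]
  refine le_of_forall_gt_imp_ge_of_dense fun L hL => ?_
  rw [ENNReal.div_le_iff' hc0 ENNReal.coe_ne_top]
  rcases eq_or_ne L ∞ with rfl | hLtop
  · rw [ENNReal.mul_top hc0]
    exact le_top
  lift L to ℝ≥0 using hLtop
  have hL0 : 0 < (L : ℝ) := by
    have : (0 : ℝ≥0∞) < L := (zero_le).trans_lt hL
    exact_mod_cast this
  have hIL : I ≤ ENNReal.ofReal ((L : ℝ) ^ p) := by
    rw [← ENNReal.ofReal_rpow_of_pos hL0, ENNReal.ofReal_coe_nnreal,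
      ← ENNReal.rpow_inv_le_iff hp0, ← one_div]
    exact hL.le
  calc _ ≤ ((c : ℝ≥0∞) * ENNReal.ofReal L ^ (δ * p / (δ - p * κ))) ^ ((δ - p * κ) / (δ * p)) :=
        ENNReal.rpow_le_rpow (hc f L hL0 hIL) hs0.le
    _ = (c : ℝ≥0∞) ^ ((δ - p * κ) / (δ * p)) * L := by
        rw [ENNReal.mul_rpow_of_nonneg _ _ hs0.le, ← ENNReal.rpow_mul,
          div_mul_div_cancel₀ hd.ne', div_self (by positivity), ENNReal.rpow_one,
          ENNReal.ofReal_coe_nnreal]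
    _ ≤ _ := by
        rw [ENNReal.coe_add, ENNReal.coe_rpow_of_nonneg _ hs0.le]
        gcongr
        exact le_self_add
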